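/- **Corollary 5.4.** Consider the following bandit game over a finite ground set $G$ with a family $\mathcal S$ of feasible subsets of $G$. It lasts $T\ge 2$ rounds, and $G$, $\mathcal S$ and $T$ are known to the player. An oblivious adversary fixes set functions $g_1,\dots,g_T: 2^G\to\mathbb R$ in advance, each monotone, submodular, with $g_t(\emptyset)=0$ and $0\le g_t(S)\le M$ for all $S\in\mathcal S$. In round $t$ the player, who may randomize, chooses a set $S_t\in\mathcal S$ on the basis of the numbers $g_1(S_1),\dots,g_{t-1}(S_{t-1})$ and of its internal randomness only, and then observes only $g_t(S_t)$. The expected $(1-1/e)$-regret is $$\mathcal R_{1-1/e}(T)=\max_{S^*\in\mathcal S}\ \mathbb E\Big[\sum_{t=1}^T\big((1-1/e)\,g_t(S^*)-g_t(S_t)\big)\Big].$$ There is a function $C:\mathbb R\to\mathbb R$ such that the following holds. 1. (Partition matroid.) Let $G$ be a finite set partitioned into parts $G_1,\dots,G_K$, let $r_1,\dots,r_K$ be positive integers, and let $\mathcal S=\{A\subseteq G : |A\cap G_k|\le r_k \text{ for all } k\}$. For every $T\ge 2$ there is a randomized algorithm, not depending on $M$ or on the functions $g_t$, such that for every $M$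 and all $g_1,\dots,g_T$ as above $$\mathcal R_{1-1/e}(T)\le C(M)\Big(\sum_{k=1}^K r_k|G_k|\Big)^{5/3}T^{2/3}\log T .$$ 2. (Bandit assignment problem, the special case $r_k=1$.) Let $V_1,\dots,V_K$ be finite sets of items for positions $1,\dots,K$, let $G=\{(k,v): 1\le k\le K,\ v\in V_k\}$, and let $\mathcal S$ be the family of all $A\subseteq G$ that contain at most one pair $(k,v)$ for each position $k$. For every $T\ge 2$ there is a randomized algorithm, not depending on $M$ or on the functions $g_t$, such that for every $M$ and all $g_1,\dots,g_T$ as above $$\mathcal R_{1-1/e}(T)\le C(M)\,|G|^{5/3}\,T^{2/3}\log T,\qquad |G|=\sum_{k=1}^K|V_k| .$$ -/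

import Mathlib

open MeasureTheory

universe u

/-- A randomized algorithm for the adversarial bandit game with action set `𝒜`.
A random seed is drawn once from a probability space; in round `t` (rounds are numbered from `0`)
the action is a function of the seed and of the rewards observed in the rounds `0, …, t - 1`, and
of nothing else. (The algorithm's own earlier actions are themselves determined by the seed and the
earlier rewards.) -/
structure BanditAlgorithm (𝒜 : Type u) where
  Seed : Type
  [measurableSpace : MeasurableSpace Seed]
  law : Measure Seed
  [isProbabilityMeasure : IsProbabilityMeasure law]
  act : (t : ℕ) → (Fin t → ℝ) → Seed → 𝒜
  measurable_act : ∀ t, Measurable[_, ⊤] fun p : (Fin t → ℝ) × Seed => act t p.1 p.2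

namespace BanditAlgorithm

attribute [instance] measurableSpace isProbabilityMeasure

variable {𝒜 : Type u}

/-- The action played in round `t` against the reward sequence `f`, as a function of the seed:
the feedback from round `s` is the single number `f s (play s)`. -/
def play (alg : BanditAlgorithm 𝒜) (f : ℕ → 𝒜 → ℝ) (ω : alg.Seed) (t : ℕ) : 𝒜 :=
  alg.act t (fun s : Fin t => f s (alg.play f ω s)) ω
termination_by t
decreasing_by exact s.2

theorem play_eq (alg : BanditAlgorithm 𝒜) (f : ℕ → 𝒜 → ℝ) (ω : alg.Seed) (t : ℕ) :
    alg.play f ω t = alg.act t (fun s : Fin t => f s (alg.play f ω s)) ω := by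
  rw [play]

/-- The expected `α`-regret over `T` rounds,
`max_{x} E [∑_{t < T} (α f_t(x) - f_t(x_t))]`, against the oblivious reward sequence `f`.
It is used for finite nonempty `𝒜`, where the supremum is a maximum and the integrand is
a measurable function with finitely many values. -/
noncomputable def regret (alg : BanditAlgorithm 𝒜) (α : ℝ) (f : ℕ → 𝒜 → ℝ) (T : ℕ) : ℝ :=
  ⨆ x : 𝒜, ∫ ω, ∑ t ∈ Finset.range T, (α * f t x - f t (alg.play f ω t)) ∂alg.law

end BanditAlgorithm

/-- `g` is a monotone submodular set function on the ground set `G` with `g ∅ = 0`, whose values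
on the admissible sets `𝒮` are at most `M` (they are nonnegative by monotonicity). -/
structure IsMonotoneSubmodularReward {G : Type u} [DecidableEq G] (𝒮 : Set (Finset G)) (M : ℝ)
    (g : Finset G → ℝ) : Prop where
  monotone : Monotone g
  submodular : ∀ A B : Finset G, g (A ∪ B) + g (A ∩ B) ≤ g A + g B
  empty : g ∅ = 0
  le_bound : ∀ S ∈ 𝒮, g S ≤ M

/-- A partition of the ground set `G` into parts `G_1, …, G_K` with positive integer
capacities `r_1, …, r_K`. -/
structure PartitionMatroid (G : Type u) where
  K : ℕ
  part : Fin K → Finset G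
  existsUnique_part : ∀ s : G, ∃! k, s ∈ part k
  capacity : Fin K → ℕ
  capacity_pos : ∀ k, 0 < capacity k

namespace PartitionMatroid

/-- The independent sets: those `A` with `|A ∩ G_k| ≤ r_k` for all `k`. -/
def indep {G : Type u} [DecidableEq G] (P : PartitionMatroid G) : Set (Finset G) :=
  {A | ∀ k, (A ∩ P.part k).card ≤ P.capacity k}

/-- The quantity `∑_k r_k |G_k|`. -/
def size {G : Type u} (P : PartitionMatroid G) : ℕ :=
  ∑ k, P.capacity k * (P.part k).card

end PartitionMatroid

/-- The action set of the assignment problem with `K` positions, in which position `k` can receive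
an item of `V k`. The ground set consists of the pairs (position, item), and an action is a set of
such pairs that gives at most one item to each position. -/
def assignments {K : ℕ} (V : Fin K → Type u) : Set (Finset ((k : Fin K) × V k)) :=
  {A | ∀ p ∈ A, ∀ q ∈ A, p.1 = q.1 → p = q}

/-!
# Bandit submodular maximization over a partition matroid

Both parts are instances of a game with slots `i`, each to be filled with an item from a finite set
`V i`: a part `G_k` of a partition matroid gives `r_k` slots with items `G_k`, and a position of the
assignment problem gives one slot. The number `n` of pairs of a slot and an item is at most
`∑ r_k |G_k|`, resp. `∑ |V_k|`, the feasible sets are images of partial assignments, and each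
feasible set is contained in the image of a full one.

The strategy runs exponential weights separately on every slot and plays the resulting independent
items `a`. With probability `γ` a round is used for exploration: a random level `j` and independent
uniform colours in `{0, …, N - 1}` of the slots select the slots with colour at most `j`, the
assignment is restricted to them, and a uniformly random item is put into its slot. The reward
observed, weighted by `(N / (N + 1)) ^ (N - j) * n / γ`, is added to the score of that item. No
base value has to be subtracted from it, since exponential weights on a slot only depend on score
differences.

The comparison with the optimum is a boosting inequality (`IsSlotReward.boosting`): for every
drawn `a` and every full assignment `y`, the discounted gains from exchanging single items of `a`
for those of `y` add up, on average over levels and colours, to at least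
`(1 - (N / (N + 1)) ^ N) f(y) - f(a)`. Submodularity gives, for one level, `f(y)` minus the value at
the level minus the marginals of the selected slots, the latter are at most `N` times the increment
from the preceding level, and the discounts make the sum over levels telescope. Since the items are
independent, the gain of the item of `a` itself is the gain of a freshly drawn one
(`sum_prod_mul_eq_resample`), so that the left-hand side is a linear regret, slot by slot. The
exponential weights inequality (`expPotential_update_sub_le`) bounds it by the decrease of a
log-sum-exp potential plus a second-order term (`IsSlotReward.sum_drawWeight_mul_le`).

Summing over the rounds is done once for all strategies driven by a state and a draw from a finite
set (`exists_banditAlgorithm_integral_le`). The resulting bound is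
`T (2 γ M + η e^M M² n² / γ + M / N) + n / η`, and `γ = n^(5/3) T^(-1/3)`,
`η = n^(-2/3) T^(-2/3)`, `N = T` give `O_M (n^(5/3) T^(2/3))`. If `γ > 1`, then the trivial bound
`M T` is of this order.
-/

/-! ### Realizing a Markov decision rule as a bandit algorithm -/

/-- A measurable family of probability vectors `w s` on a finite set is simulated by a jointly
measurable map of the parameter `s` and a uniform variable on the unit interval. -/
theorem exists_measurable_sampler {S D : Type*} [MeasurableSpace S] [Fintype D] [Nonempty D]
    [MeasurableSpace D] [DiscreteMeasurableSpace D] (w : S → D → ℝ) (hw0 : ∀ s d, 0 ≤ w s d)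
    (hw1 : ∀ s, ∑ d, w s d = 1) (hwm : ∀ d, Measurable fun s => w s d) :
    ∃ draw : S → unitInterval → D, Measurable (Function.uncurry draw) ∧
      ∀ s (h : D → ℝ), ∫ v, h (draw s v) = ∑ d, w s d * h d := by
  classical
  have hval : ∀ s d, (∑ d', ENNReal.ofReal (w s d') • Measure.dirac d') {d}
      = ENNReal.ofReal (w s d) := by
    intro s d
    rw [Measure.finsetSum_apply]
    simp [Set.indicator_apply]
  let κ : ProbabilityTheory.Kernel S D :=
    { toFun := fun s => ∑ d, ENNReal.ofReal (w s d) • Measure.dirac d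
      measurable' := by
        refine Measure.measurable_of_measurable_coe _ fun A _ => ?_
        simp only [Measure.finsetSum_apply, Measure.smul_apply, smul_eq_mul]
        exact Finset.measurable_sum _ fun d _ => ((hwm d).ennreal_ofReal).mul_const _ }
  have hκ : ∀ s, κ s = ∑ d, ENNReal.ofReal (w s d) • Measure.dirac d := fun s => rfl
  have : ProbabilityTheory.IsMarkovKernel κ := by
    refine ⟨fun s => ⟨?_⟩⟩
    rw [hκ, Measure.finsetSum_apply]
    simp only [Measure.smul_apply, measure_univ, smul_eq_mul, mul_one]
    rw [← ENNReal.ofReal_sum_of_nonneg fun d _ => hw0 s d, hw1, ENNReal.ofReal_one]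
  obtain ⟨draw, hm, hlaw⟩ := κ.exists_measurable_map_eq_unitInterval
  refine ⟨draw, hm, fun s h => ?_⟩
  have hms : Measurable (draw s) := hm.comp measurable_prodMk_left
  have hh : Measurable h := measurable_of_countable h
  rw [← integral_map (f := h) hms.aemeasurable hh.aestronglyMeasurable, hlaw,
    integral_fintype Integrable.of_finite]
  refine Finset.sum_congr rfl fun d _ => ?_
  rw [measureReal_def, hκ, hval, ENNReal.toReal_ofReal (hw0 s d), smul_eq_mul]

/-- The state after `t` steps of the random recursion `s ↦ U t s d`, in which `d` is drawn by the
sampler `draw` from the current state and the `t`-th seed coordinate. -/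
def trajectory {S D I : Type*} (draw : S → I → D) (U : ℕ → S → D → S) (s₀ : S) (ω : ℕ → I) : ℕ → S
  | 0 => s₀
  | t + 1 => U t (trajectory draw U s₀ ω t) (draw (trajectory draw U s₀ ω t) (ω t))

/-- The state at time `t` depends only on the seed coordinates before `t` and on the updates made
along the way. -/
theorem trajectory_congr {S D I : Type*} {draw : S → I → D} {U U' : ℕ → S → D → S} {s₀ : S}
    {ω ω' : ℕ → I} {t : ℕ} (hω : ∀ i < t, ω i = ω' i)
    (hU : ∀ i < t, U i (trajectory draw U s₀ ω i) (draw (trajectory draw U s₀ ω i) (ω i)) =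
      U' i (trajectory draw U s₀ ω i) (draw (trajectory draw U s₀ ω i) (ω i))) :
    trajectory draw U s₀ ω t = trajectory draw U' s₀ ω' t := by
  induction t with
  | zero => rfl
  | succ t ih =>
    have h := ih (fun i hi => hω i (hi.trans t.lt_succ_self))
      (fun i hi => hU i (hi.trans t.lt_succ_self))
    rw [trajectory, hU t t.lt_succ_self, trajectory, ← h, hω t t.lt_succ_self]

theorem finite_range_trajectory {S D I : Type*} [Finite D] (draw : S → I → D)
    (U : ℕ → S → D → S) (s₀ : S) (t : ℕ) :
    (Set.range fun ω => trajectory draw U s₀ ω t).Finite := by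
  induction t with
  | zero => exact (Set.finite_singleton s₀).subset (by rintro _ ⟨ω, rfl⟩; rfl)
  | succ t ih =>
    refine (Set.Finite.image2 (U t) ih (Set.finite_univ (α := D))).subset ?_
    rintro _ ⟨ω, rfl⟩
    exact ⟨_, ⟨ω, rfl⟩, _, Set.mem_univ _, rfl⟩

theorem measurable_trajectory {S D I Z : Type*} [MeasurableSpace S] [MeasurableSpace I]
    [MeasurableSpace Z] [Countable D] [MeasurableSpace D] [DiscreteMeasurableSpace D]
    {draw : S → I → D} (hdraw : Measurable (Function.uncurry draw)) {U : Z → ℕ → S → D → S}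
    (hU : ∀ t d, Measurable fun p : Z × S => U p.1 t p.2 d) (s₀ : S) (t : ℕ) :
    Measurable fun p : Z × (ℕ → I) => trajectory draw (U p.1) s₀ p.2 t := by
  induction t with
  | zero => exact measurable_const
  | succ t ih =>
    have hd : Measurable fun p : Z × (ℕ → I) =>
        draw (trajectory draw (U p.1) s₀ p.2 t) (p.2 t) :=
      hdraw.comp (ih.prodMk ((measurable_pi_apply t).comp measurable_snd))
    have hU' : Measurable fun q : D × (Z × S) => U q.2.1 t q.2.2 q.1 :=
      measurable_from_prod_countable_right fun d => hU t d
    exact hU'.comp (hd.prodMk (measurable_fst.prodMk ih))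

theorem measurable_trajectory_seed {S D I : Type*} [MeasurableSpace S] [MeasurableSpace I]
    [Countable D] [MeasurableSpace D] [DiscreteMeasurableSpace D] {draw : S → I → D}
    (hdraw : Measurable (Function.uncurry draw)) {U : ℕ → S → D → S}
    (hU : ∀ t d, Measurable fun s => U t s d) (s₀ : S) (t : ℕ) :
    Measurable fun ω : ℕ → I => trajectory draw U s₀ ω t :=
  (measurable_trajectory (Z := Unit) (U := fun _ => U) hdraw
    (fun t d => (hU t d).comp measurable_snd) s₀ t).comp (measurable_prodMk_left (x := ()))

/-- The state at time `t` is independent of the `t`-th seed coordinate, so the latter may be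
integrated out first. -/
theorem integral_trajectory {S D I : Type*} [MeasurableSpace S] [MeasurableSpace I]
    [Countable D] [MeasurableSpace D] [DiscreteMeasurableSpace D] (μ : Measure I)
    [IsProbabilityMeasure μ] {draw : S → I → D} (hdraw : Measurable (Function.uncurry draw))
    {U : ℕ → S → D → S} (hU : ∀ t d, Measurable fun s => U t s d) (s₀ : S) (t : ℕ)
    {H : S × I → ℝ} (hH : Measurable H)
    (hint : Integrable (fun ω => H (trajectory draw U s₀ ω t, ω t))
      (Measure.infinitePi fun _ : ℕ => μ)) :
    ∫ ω, H (trajectory draw U s₀ ω t, ω t) ∂(Measure.infinitePi fun _ : ℕ => μ) =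
      ∫ ω, ∫ v, H (trajectory draw U s₀ ω t, v) ∂μ ∂(Measure.infinitePi fun _ : ℕ => μ) := by
  classical
  set P := Measure.infinitePi fun _ : ℕ => μ with hP
  obtain ⟨i₀⟩ : Nonempty I := μ.nonempty_of_neZero
  have hYm : Measurable fun ω => trajectory draw U s₀ ω t :=
    measurable_trajectory_seed hdraw hU s₀ t
  -- The state is a function of the seed coordinates below `t`.
  let G : ((i : Finset.range t) → I) → S := fun v =>
    trajectory draw U s₀ (fun i => if h : i ∈ Finset.range t then v ⟨i, h⟩ else i₀) t
  have hG : Measurable G := by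
    refine hYm.comp (measurable_pi_lambda _ fun i => ?_)
    by_cases h : i ∈ Finset.range t
    · simp only [h, dite_true]; exact measurable_pi_apply _
    · simp only [h, dite_false]; exact measurable_const
  have hYG : (fun ω => trajectory draw U s₀ ω t) =
      G ∘ fun ω (i : Finset.range t) => ω i := by
    funext ω
    refine trajectory_congr (fun i hi => ?_) (fun _ _ => rfl)
    simp [hi]
  have hind : ProbabilityTheory.IndepFun (fun ω => trajectory draw U s₀ ω t)
      (fun ω : ℕ → I => ω t) P := by
    have h1 := (ProbabilityTheory.iIndepFun_infinitePi (P := fun _ : ℕ => μ)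
      (X := fun _ x => x) (fun _ => measurable_id)).indepFun_finset (Finset.range t) {t}
      (by simp) (fun i => measurable_pi_apply i)
    have h2 := h1.comp hG (measurable_pi_apply (⟨t, by simp⟩ : ({t} : Finset ℕ)))
    rw [hYG]
    exact h2
  have hprod := hind.map_prod_eq_prod_map_map hYm.aemeasurable (measurable_pi_apply t).aemeasurable
  rw [hP, Measure.infinitePi_map_eval, ← hP] at hprod
  have hpair : Measurable fun ω : ℕ → I => (trajectory draw U s₀ ω t, ω t) :=
    hYm.prodMk (measurable_pi_apply t)
  have hint' : Integrable H ((P.map fun ω => trajectory draw U s₀ ω t).prod μ) := by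
    rw [← hprod]
    exact (integrable_map_measure hH.aestronglyMeasurable hpair.aemeasurable).2 hint
  have hpm : IsProbabilityMeasure (P.map fun ω => trajectory draw U s₀ ω t) :=
    Measure.isProbabilityMeasure_map hYm.aemeasurable
  rw [← integral_map (φ := fun ω => (trajectory draw U s₀ ω t, ω t)) (f := H)
    hpair.aemeasurable hH.aestronglyMeasurable, hprod, integral_prod _ hint',
    integral_map (f := fun s => ∫ v, H (s, v) ∂μ) hYm.aemeasurable
      (hH.stronglyMeasurable.integral_prod_right').aestronglyMeasurable]

theorem Measurable.integrable_of_finite_range {Ω : Type*} [MeasurableSpace Ω] {P : Measure Ω}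
    [IsFiniteMeasure P] {g : Ω → ℝ} (hg : Measurable g) (hfin : (Set.range g).Finite) :
    Integrable g P := by
  obtain ⟨C, hC⟩ := hfin.isBounded.exists_norm_le
  exact Integrable.of_bound hg.aestronglyMeasurable C
    (Filter.Eventually.of_forall fun ω => hC _ ⟨ω, rfl⟩)

/-- The potential method. A player keeps a state `s`, draws `d` from the probability vector `w s`,
plays `act d` and updates the state with the observed reward. If, from every state, the expected
one-round loss plus the expected increase of a nonnegative potential `Φ` is at most `ε`, then the
expected total loss over `T` rounds is at most `T ε` plus the initial potential. The algorithm
depends neither on the rewards, nor on the losses, nor on the potential. -/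
theorem exists_banditAlgorithm_integral_le {𝒜 : Type u} {S D : Type*} [MeasurableSpace S]
    [Fintype D] [Nonempty D] (w : S → D → ℝ) (hw0 : ∀ s d, 0 ≤ w s d)
    (hw1 : ∀ s, ∑ d, w s d = 1) (hwm : ∀ d, Measurable fun s => w s d) (act : D → 𝒜)
    (upd : S → D → ℝ → S) (hupd : ∀ d, Measurable fun p : S × ℝ => upd p.1 d p.2) (s₀ : S) :
    ∃ alg : BanditAlgorithm 𝒜, ∀ (f ℓ : ℕ → 𝒜 → ℝ) (Φ : S → ℝ) (T : ℕ) (ε : ℝ),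
      Measurable Φ → (∀ s, 0 ≤ Φ s) →
      (∀ t < T, ∀ s, ∑ d, w s d * (ℓ t (act d) + (Φ (upd s d (f t (act d))) - Φ s)) ≤ ε) →
      ∫ ω, ∑ t ∈ Finset.range T, ℓ t (alg.play f ω t) ∂alg.law ≤ T * ε + Φ s₀ := by
  classical
  let mD : MeasurableSpace D := ⊤
  have hD : DiscreteMeasurableSpace D := ⟨fun _ => trivial⟩
  obtain ⟨draw, hdraw, hlaw⟩ := exists_measurable_sampler w hw0 hw1 hwm
  let ext : (t : ℕ) → (Fin t → ℝ) → ℕ → ℝ := fun t r s => if h : s < t then r ⟨s, h⟩ else 0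
  have hext : ∀ t, Measurable (ext t) := by
    refine fun t => measurable_pi_lambda _ fun s => ?_
    by_cases h : s < t
    · simp only [ext, h, dite_true]; exact measurable_pi_apply _
    · simp only [ext, h, dite_false]; exact measurable_const
  let state : (ℕ → ℝ) → (ℕ → unitInterval) → ℕ → S := fun r ω =>
    trajectory draw (fun t s d => upd s d (r t)) s₀ ω
  have hstate : ∀ t, Measurable fun p : (ℕ → ℝ) × (ℕ → unitInterval) => state p.1 p.2 t := by
    refine fun t => measurable_trajectory (Z := ℕ → ℝ) (U := fun r t s d => upd s d (r t)) hdraw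
      (fun t d => ?_) s₀ t
    exact (hupd d).comp (measurable_snd.prodMk ((measurable_pi_apply t).comp measurable_fst))
  let alg : BanditAlgorithm 𝒜 :=
    { Seed := ℕ → unitInterval
      law := Measure.infinitePi fun _ => volume
      act := fun t r ω => act (draw (state (ext t r) ω t) (ω t))
      measurable_act := by
        intro t
        have h1 : Measurable fun p : (Fin t → ℝ) × (ℕ → unitInterval) =>
            draw (state (ext t p.1) p.2 t) (p.2 t) :=
          hdraw.comp (((hstate t).comp (((hext t).comp measurable_fst).prodMk
            measurable_snd)).prodMk ((measurable_pi_apply t).comp measurable_snd))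
        have h2 : Measurable[mD, ⊤] act := fun _ _ => trivial
        exact h2.comp h1 }
  refine ⟨alg, fun f ℓ Φ T ε hΦm hΦ0 hstep => ?_⟩
  let U : ℕ → S → D → S := fun t s d => upd s d (f t (act d))
  let Y : (ℕ → unitInterval) → ℕ → S := fun ω => trajectory draw U s₀ ω
  have hU : ∀ t d, Measurable fun s => U t s d := fun t d =>
    (hupd d).comp (measurable_id.prodMk measurable_const)
  have hplay : ∀ (ω : ℕ → unitInterval) t, alg.play f ω t = act (draw (Y ω t) (ω t)) := by
    intro ω t
    induction t using Nat.strong_induction_on with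
    | _ t ih =>
      rw [BanditAlgorithm.play_eq]
      have : state (ext t fun s : Fin t => f s (alg.play f ω s)) ω t = Y ω t := by
        refine (trajectory_congr (fun _ _ => rfl) fun i hi => ?_).symm
        simp only [U, ext, hi, dite_true, ih i hi, Y]
      exact congrArg (fun s => act (draw s (ω t))) this
  have hYm : ∀ t, Measurable fun ω => Y ω t := fun t =>
    measurable_trajectory_seed hdraw hU s₀ t
  have hdm : ∀ t, Measurable fun ω : ℕ → unitInterval => draw (Y ω t) (ω t) := fun t =>
    hdraw.comp ((hYm t).prodMk (measurable_pi_apply t))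
  have hℓm : ∀ t, Measurable fun d => ℓ t (act d) := fun t => measurable_of_countable _
  set P : Measure (ℕ → unitInterval) := Measure.infinitePi fun _ => volume with hP
  have hℓint : ∀ t, Integrable (fun ω => ℓ t (act (draw (Y ω t) (ω t)))) P := by
    refine fun t => ((hℓm t).comp (hdm t)).integrable_of_finite_range ?_
    refine (Set.finite_range fun d => ℓ t (act d)).subset ?_
    rintro _ ⟨ω, rfl⟩
    exact ⟨_, rfl⟩
  have hΦint : ∀ t, Integrable (fun ω => Φ (Y ω t)) P := by
    refine fun t => (hΦm.comp (hYm t)).integrable_of_finite_range ?_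
    refine ((finite_range_trajectory draw U s₀ t).image Φ).subset ?_
    rintro _ ⟨ω, rfl⟩
    exact ⟨_, ⟨ω, rfl⟩, rfl⟩
  have hone : ∀ t < T, ∫ ω, ℓ t (act (draw (Y ω t) (ω t))) ∂P +
      (∫ ω, Φ (Y ω (t + 1)) ∂P - ∫ ω, Φ (Y ω t) ∂P) ≤ ε := by
    intro t ht
    have hΔint : Integrable (fun ω => Φ (Y ω (t + 1)) - Φ (Y ω t)) P :=
      (hΦint (t + 1)).sub (hΦint t)
    rw [← integral_sub (hΦint _) (hΦint _), ← integral_add (hℓint t) hΔint]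
    let h : S → D → ℝ := fun s d => ℓ t (act d) + (Φ (U t s d) - Φ s)
    let H : S × unitInterval → ℝ := fun p => h p.1 (draw p.1 p.2)
    have hHm : Measurable H := by
      have h1 : Measurable fun q : D × S => h q.2 q.1 :=
        measurable_from_prod_countable_right fun d =>
          ((hΦm.comp (hU t d)).sub hΦm).const_add (ℓ t (act d))
      exact h1.comp (hdraw.prodMk measurable_fst)
    have hHint : Integrable (fun ω => H (Y ω t, ω t)) P :=
      (hℓint t).add hΔint
    calc ∫ ω, ℓ t (act (draw (Y ω t) (ω t))) + (Φ (Y ω (t + 1)) - Φ (Y ω t)) ∂P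
        = ∫ ω, H (Y ω t, ω t) ∂P := rfl
      _ = ∫ ω, (∫ v, H (Y ω t, v)) ∂P := integral_trajectory volume hdraw hU s₀ t hHm hHint
      _ = ∫ ω, ∑ d, w (Y ω t) d * h (Y ω t) d ∂P := by
          refine integral_congr_ae (Filter.Eventually.of_forall fun ω => ?_)
          exact hlaw (Y ω t) (h (Y ω t))
      _ ≤ ∫ _, ε ∂P := by
          refine integral_mono ?_ (integrable_const _) fun ω => hstep t ht (Y ω t)
          have hG : Measurable fun s => ∑ d, w s d * h s d :=
            Finset.measurable_sum _ fun d _ =>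
              (hwm d).mul (((hΦm.comp (hU t d)).sub hΦm).const_add (ℓ t (act d)))
          refine (hG.comp (hYm t)).integrable_of_finite_range ?_
          refine ((finite_range_trajectory draw U s₀ t).image fun s => ∑ d, w s d * h s d).subset ?_
          rintro _ ⟨ω, rfl⟩
          exact ⟨_, ⟨ω, rfl⟩, rfl⟩
      _ = ε := by simp
  have hsum : ∑ t ∈ Finset.range T, ∫ ω, ℓ t (act (draw (Y ω t) (ω t))) ∂P +
      (∫ ω, Φ (Y ω T) ∂P - ∫ ω, Φ (Y ω 0) ∂P) ≤ T * ε := by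
    rw [← Finset.sum_range_sub fun t => ∫ ω, Φ (Y ω t) ∂P, ← Finset.sum_add_distrib]
    refine (Finset.sum_le_sum fun t ht => hone t (Finset.mem_range.1 ht)).trans_eq ?_
    simp
  have h0 : ∫ ω, Φ (Y ω 0) ∂P = Φ s₀ := by simp [Y, trajectory]
  have hT : 0 ≤ ∫ ω, Φ (Y ω T) ∂P := integral_nonneg fun ω => hΦ0 _
  have hL : ∫ ω, ∑ t ∈ Finset.range T, ℓ t (alg.play f ω t) ∂alg.law =
      ∑ t ∈ Finset.range T, ∫ ω, ℓ t (act (draw (Y ω t) (ω t))) ∂P := by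
    rw [← integral_finsetSum _ fun t _ => hℓint t]
    refine integral_congr_ae (Filter.Eventually.of_forall fun ω => ?_)
    exact Finset.sum_congr rfl fun t _ => congrArg (ℓ t) (hplay ω t)
  linarith

/-! ### Marginals of monotone submodular functions -/

theorem marginal_le_of_subset {G : Type*} [DecidableEq G] {g : Finset G → ℝ} (hmono : Monotone g)
    (hsub : ∀ A B, g (A ∪ B) + g (A ∩ B) ≤ g A + g B) {X Z : Finset G} (h : X ⊆ Z) (e : G) :
    g (insert e Z) - g Z ≤ g (insert e X) - g X := by
  by_cases he : e ∈ Z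
  · rw [Finset.insert_eq_of_mem he, sub_self]
    exact sub_nonneg.2 (hmono (Finset.subset_insert e X))
  · have h1 := hsub (insert e X) Z
    have h2 : insert e X ∪ Z = insert e Z := by
      rw [Finset.insert_union, Finset.union_eq_right.2 h]
    have h3 : insert e X ∩ Z = X := by
      rw [Finset.insert_inter_of_notMem he, Finset.inter_eq_left.2 h]
    rw [h2, h3] at h1
    linarith

theorem union_image_sub_le_sum {ι G : Type*} [DecidableEq G] {g : Finset G → ℝ}
    (hmono : Monotone g) (hsub : ∀ A B, g (A ∪ B) + g (A ∩ B) ≤ g A + g B) (Z : Finset G)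
    (s : Finset ι) (y : ι → G) :
    g (Z ∪ s.image y) - g Z ≤ ∑ k ∈ s, (g (insert (y k) Z) - g Z) := by
  classical
  induction s using Finset.induction_on with
  | empty => simp
  | insert k s hk ih =>
    rw [Finset.sum_insert hk, Finset.image_insert, Finset.union_insert]
    have := marginal_le_of_subset hmono hsub
      (Finset.subset_union_left : Z ⊆ Z ∪ s.image y) (y k)
    linarith

theorem sum_sub_erase_le {ι : Type*} [DecidableEq ι] {h : Finset ι → ℝ}
    (hsub : ∀ A B, h (A ∪ B) + h (A ∩ B) ≤ h A + h B) (X B : Finset ι) :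
    ∑ b ∈ B, (h X - h (X.erase b)) ≤ h X - h (X \ B) := by
  induction B using Finset.induction_on with
  | empty => simp
  | insert b B hb ih =>
    rw [Finset.sum_insert hb]
    have h1 := hsub (X \ B) (X.erase b)
    have h2 : X \ B ∪ X.erase b = X := by
      ext i; by_cases hi : i = b
      · subst hi; simp [hb]
      · simp only [Finset.mem_union, Finset.mem_sdiff, Finset.mem_erase, ne_eq, hi]
        tauto
    have h3 : X \ B ∩ X.erase b = X \ insert b B := by
      ext i; simp only [Finset.mem_inter, Finset.mem_sdiff, Finset.mem_erase, Finset.mem_insert]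
      tauto
    rw [h2, h3] at h1
    linarith

/-! ### Rewards of partial assignments of items to slots -/

/-- A reward `F a A`, in `[0, M]`, for filling the slots in `A` according to `a` and leaving the
others empty. The two inequalities are those of a monotone submodular function: the value of a full
assignment `y` over `(a, A)` is at most the sum of the gains from putting the single items `y k`
in place of what `(a, A)` has in slot `k`, and the reward is submodular in the set of filled
slots. -/
structure IsSlotReward {ι : Type*} {V : ι → Type*} [Fintype ι] [DecidableEq ι] (M : ℝ)
    (F : (∀ i, V i) → Finset ι → ℝ) : Prop where
  nonneg : ∀ a A, 0 ≤ F a A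
  le_bound : ∀ a A, F a A ≤ M
  empty : ∀ a, F a ∅ = 0
  sub_le_sum : ∀ y a A, F y Finset.univ - F a A ≤
    ∑ k, (F (Function.update a k (y k)) (insert k A) - F a (A.erase k))
  submodular : ∀ a A B, F a (A ∪ B) + F a (A ∩ B) ≤ F a A + F a B

theorem IsMonotoneSubmodularReward.isSlotReward {ι G : Type*} {V : ι → Type*} [Fintype ι]
    [DecidableEq ι] [DecidableEq G] {𝒮 : Set (Finset G)} {M : ℝ} {g : Finset G → ℝ}
    (hg : IsMonotoneSubmodularReward 𝒮 M g) (π : ∀ i, V i → G)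
    (hπ : ∀ (a : ∀ i, V i) (A : Finset ι), A.image (fun i => π i (a i)) ∈ 𝒮) :
    IsSlotReward M fun (a : ∀ i, V i) (A : Finset ι) => g (A.image fun i => π i (a i)) where
  nonneg a A := hg.empty.ge.trans (hg.monotone (Finset.empty_subset _))
  le_bound a A := hg.le_bound _ (hπ a A)
  empty a := by simp [hg.empty]
  submodular a A B := by
    have h1 := hg.submodular (A.image fun i => π i (a i)) (B.image fun i => π i (a i))
    rw [← Finset.image_union] at h1
    have h2 := hg.monotone (Finset.image_inter_subset (fun i => π i (a i)) A B)
    linarith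
  sub_le_sum y a A := by
    set Z := A.image fun i => π i (a i) with hZ
    have h1 := union_image_sub_le_sum hg.monotone hg.submodular Z Finset.univ fun i => π i (y i)
    have h2 := hg.monotone (Finset.subset_union_right (s₁ := Z)
      (s₂ := Finset.univ.image fun i => π i (y i)))
    refine (sub_le_sub_right h2 _).trans (h1.trans (Finset.sum_le_sum fun k _ => ?_))
    have h3 : (insert k A).image (fun i => π i (Function.update a k (y k) i)) =
        insert (π k (y k)) ((A.erase k).image fun i => π i (a i)) := by
      have : insert k A = insert k (A.erase k) := by
        ext i; by_cases hi : i = k <;> simp [hi]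
      rw [this, Finset.image_insert, Function.update_self]
      congr 1
      refine Finset.image_congr fun i hi => ?_
      have hik : i ≠ k := (Finset.mem_erase.1 (Finset.mem_coe.1 hi)).1
      simp [Function.update_of_ne hik]
    rw [h3]
    exact marginal_le_of_subset hg.monotone hg.submodular
      (Finset.image_subset_image (Finset.erase_subset k A)) _

/-! ### Product weights on assignments -/

theorem sum_prod_eq_one {ι : Type*} {V : ι → Type*} [Fintype ι] [DecidableEq ι]
    [∀ i, Fintype (V i)] (x : ∀ i, V i → ℝ) (hx : ∀ i, ∑ v, x i v = 1) :
    ∑ a : ∀ i, V i, ∏ i, x i (a i) = 1 := by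
  have := Finset.prod_univ_sum (fun i => (Finset.univ : Finset (V i))) x
  rw [Fintype.piFinset_univ] at this
  rw [← this]
  simp [hx]

/-- Under a product distribution, redrawing one coordinate does not change expectations. -/
theorem sum_prod_mul_eq_resample {ι : Type*} {V : ι → Type*} [Fintype ι] [DecidableEq ι]
    [∀ i, Fintype (V i)] (x : ∀ i, V i → ℝ) (k : ι) (hx : ∑ v, x k v = 1)
    (H : (∀ i, V i) → ℝ) :
    ∑ a, (∏ i, x i (a i)) * H a =
      ∑ a, (∏ i, x i (a i)) * ∑ v, x k v * H (Function.update a k v) := by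
  let e : (∀ i, V i) × V k → (∀ i, V i) × V k := fun p => (Function.update p.1 k p.2, p.1 k)
  have he : Function.Involutive e := by
    rintro ⟨a, v⟩
    simp [e]
  have h1 : ∑ a, (∏ i, x i (a i)) * H a =
      ∑ p : (∀ i, V i) × V k, (∏ i, x i (p.1 i)) * x k p.2 * H p.1 := by
    rw [Fintype.sum_prod_type]
    refine Finset.sum_congr rfl fun a _ => ?_
    dsimp only
    rw [← Finset.sum_mul, ← Finset.mul_sum, hx, mul_one]
  rw [h1, ← Equiv.sum_comp he.toPerm, Fintype.sum_prod_type]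
  refine Finset.sum_congr rfl fun a _ => ?_
  rw [Finset.mul_sum]
  refine Finset.sum_congr rfl fun v _ => ?_
  change (∏ i, x i (Function.update a k v i)) * x k (a k) * H (Function.update a k v) = _
  rw [Fintype.prod_eq_mul_prod_compl k, Fintype.prod_eq_mul_prod_compl k fun i => x i (a i),
    Function.update_self]
  have h2 : ∏ i ∈ {k}ᶜ, x i (Function.update a k v i) = ∏ i ∈ {k}ᶜ, x i (a i) := by
    refine Finset.prod_congr rfl fun i hi => ?_
    have : i ≠ k := by simpa using hi
    rw [Function.update_of_ne this]
  rw [h2]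
  ring

/-! ### Boosting by random levels -/

/-- The slots whose colour is below `j`. -/
def levelSet {ι : Type*} [Fintype ι] {N : ℕ} (c : ι → Fin N) (j : ℕ) : Finset ι :=
  Finset.univ.filter fun i => (c i : ℕ) < j

/-- For independent uniform colours, the average sum of the marginals at a level set is at most `N`
times the average increment from the preceding level set. -/
theorem sum_sum_marginal_levelSet_le {ι : Type*} [Fintype ι] [DecidableEq ι] {N : ℕ}
    {h : Finset ι → ℝ} (hsub : ∀ A B, h (A ∪ B) + h (A ∩ B) ≤ h A + h B) (j : Fin N) :
    ∑ c : ι → Fin N, ∑ k, (h (insert k (levelSet c (j + 1))) - h ((levelSet c (j + 1)).erase k)) ≤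
      N * ∑ c : ι → Fin N, (h (levelSet c (j + 1)) - h (levelSet c j)) := by
  have hN : (0 : ℝ) < N := by exact_mod_cast j.pos
  let q : ι → (ι → Fin N) → ℝ := fun k c =>
    h (insert k (levelSet c (j + 1))) - h ((levelSet c (j + 1)).erase k)
  -- The marginal of slot `k` does not depend on its colour, which is `j` with probability `1 / N`.
  have hq : ∀ k, ∑ c, q k c = N * ∑ c : ι → Fin N, if c k = j then q k c else 0 := by
    intro k
    have hinv : ∀ c v, q k (Function.update c k v) = q k c := by
      intro c v
      have h1 : insert k (levelSet (Function.update c k v) (j + 1)) =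
          insert k (levelSet c (j + 1)) := by
        ext i; by_cases hi : i = k <;> simp [levelSet, hi]
      have h2 : (levelSet (Function.update c k v) (j + 1)).erase k =
          (levelSet c (j + 1)).erase k := by
        ext i; by_cases hi : i = k <;> simp [levelSet, hi]
      simp only [q, h1, h2]
    have h3 := sum_prod_mul_eq_resample (fun (_ : ι) (_ : Fin N) => (N : ℝ)⁻¹) k
      (by simp [hN.ne']) fun c => if c k = j then q k c else 0
    simp only [Function.update_self, hinv, Finset.prod_const, ← Finset.mul_sum] at h3
    have h4 := mul_left_cancel₀ (pow_ne_zero _ (inv_ne_zero hN.ne')) h3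
    rw [h4]
    simp [hN.ne']
  rw [Finset.sum_comm, Finset.sum_congr rfl fun k _ => hq k, ← Finset.mul_sum, Finset.sum_comm]
  refine mul_le_mul_of_nonneg_left (Finset.sum_le_sum fun c _ => ?_) hN.le
  have h5 := sum_sub_erase_le hsub (levelSet c (j + 1)) (Finset.univ.filter fun k => c k = j)
  have h6 : levelSet c (j + 1) \ (Finset.univ.filter fun k => c k = j) = levelSet c j := by
    ext i
    simp only [levelSet, Finset.mem_sdiff, Finset.mem_filter, Finset.mem_univ, true_and, Fin.ext_iff]
    omega
  rw [h6, Finset.sum_filter] at h5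
  refine le_trans (Finset.sum_le_sum fun k _ => ?_) h5
  split_ifs with hk
  · have : insert k (levelSet c (j + 1)) = levelSet c (j + 1) :=
      Finset.insert_eq_of_mem (by simp [levelSet, hk])
    simp only [q, this, le_refl]
  · exact le_rfl

/-- The discount factor `N / (N + 1)`, whose `N`-th power tends to `1 / e`. -/
noncomputable def discount (N : ℕ) : ℝ := N / (N + 1)

/-- The boosting inequality. Weighting the level `j + 1` by `discount N ^ (N - j)` turns the gains
from exchanging single items of a partial assignment into the full comparison of `y` with `a`, at
the price of the factor `1 - discount N ^ N`. It is a discrete form of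
`∫₀¹ e^(z-1) (f(y) - φ(z) - φ'(z)) dz = (1 - 1/e) f(y) - φ(1)` for the multilinear extension `φ` along
a ray with `φ(0) = 0`. -/
theorem IsSlotReward.boosting {ι : Type*} {V : ι → Type*} [Fintype ι] [DecidableEq ι] {M : ℝ}
    {F : (∀ i, V i) → Finset ι → ℝ} (hF : IsSlotReward M F) {N : ℕ} (hN : 0 < N)
    (y a : ∀ i, V i) :
    ∑ j : Fin N, ∑ c : ι → Fin N, discount N ^ (N - j : ℕ) / (N * N ^ Fintype.card ι) *
      ∑ k, (F a (insert k (levelSet c (j + 1))) -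
        F (Function.update a k (y k)) (insert k (levelSet c (j + 1)))) ≤
      F a Finset.univ - (1 - discount N ^ N) * F y Finset.univ := by
  have hN' : (0 : ℝ) < N := by exact_mod_cast hN
  have hρ : 0 < discount N := by unfold discount; positivity
  let Q : ℝ := (N : ℝ) ^ Fintype.card ι
  have hQ : 0 < Q := by positivity
  have hcard : ∑ _c : ι → Fin N, (1 : ℝ) = Q := by simp [Q]
  let φ : ℕ → ℝ := fun j => (∑ c : ι → Fin N, F a (levelSet c j)) / Q
  let r : ℕ → ℝ := fun j => discount N ^ (N - j)
  have hr : ∀ j < N, r j * (N + 1) = r (j + 1) * N := by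
    intro j hj
    have : N - j = (N - (j + 1)) + 1 := by omega
    simp only [r, this, pow_succ]
    unfold discount
    field_simp
  have hφ0 : φ 0 = 0 := by simp [φ, levelSet, hF.empty]
  have hφN : φ N = F a Finset.univ := by
    have : ∀ c : ι → Fin N, levelSet c N = Finset.univ := fun c => by simp [levelSet]
    simp only [φ, this, Finset.sum_const, nsmul_eq_mul]
    simp only [Finset.sum_const, nsmul_eq_mul, mul_one] at hcard
    rw [hcard]
    field_simp
  have hstep : ∀ j : Fin N, ∑ c : ι → Fin N, discount N ^ (N - j : ℕ) / (N * N ^ Fintype.card ι) *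
      ∑ k, (F a (insert k (levelSet c (j + 1))) -
        F (Function.update a k (y k)) (insert k (levelSet c (j + 1)))) ≤
      (r (j + 1) * φ (j + 1) - r j * φ j) - (r (j + 1) - r j) * F y Finset.univ := by
    intro j
    have h1 := sum_sum_marginal_levelSet_le (hF.submodular a) j
    have h2 : ∑ c : ι → Fin N, ∑ k, (F a (insert k (levelSet c (j + 1))) -
        F (Function.update a k (y k)) (insert k (levelSet c (j + 1)))) ≤
        N * (Q * φ (j + 1) - Q * φ j) - Q * F y Finset.univ + Q * φ (j + 1) := by
      have h3 : ∀ j, Q * φ j = ∑ c : ι → Fin N, F a (levelSet c j) := fun j => by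
        simp only [φ]; field_simp
      rw [h3, h3, ← Finset.sum_sub_distrib, ← hcard, Finset.sum_mul]
      refine le_trans ?_ (add_le_add_left (sub_le_sub_right h1 _) _)
      rw [← Finset.sum_sub_distrib, ← Finset.sum_add_distrib]
      refine Finset.sum_le_sum fun c _ => ?_
      have h4 := hF.sub_le_sum y a (levelSet c (j + 1))
      rw [Finset.sum_sub_distrib] at h4 ⊢
      rw [Finset.sum_sub_distrib]
      linarith
    rw [← Finset.mul_sum]
    have hw : 0 ≤ discount N ^ (N - j : ℕ) / (N * N ^ Fintype.card ι) := by positivity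
    refine (mul_le_mul_of_nonneg_left h2 hw).trans_eq ?_
    have h5 := hr j j.2
    have h6 : r (j + 1) = r j * (N + 1) / N := by field_simp; linarith
    rw [h6]
    change r j / (N * Q) * _ = _
    field_simp
    ring
  refine (Finset.sum_le_sum fun j _ => hstep j).trans_eq ?_
  rw [Finset.sum_sub_distrib, ← Finset.sum_mul,
    Fin.sum_univ_eq_sum_range (fun j => r (j + 1) * φ (j + 1) - r j * φ j),
    Fin.sum_univ_eq_sum_range (fun j => r (j + 1) - r j), Finset.sum_range_sub r,
    Finset.sum_range_sub fun j => r j * φ j, hφ0, hφN]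
  simp [r]

/-! ### Exponential weights on every slot -/

/-- The exponential weights distribution on the items of slot `i`, for the scores `s`. -/
noncomputable def expWeights {ι : Type*} {V : ι → Type*} [∀ i, Fintype (V i)] (η : ℝ)
    (s : (Σ i, V i) → ℝ) (i : ι) (v : V i) : ℝ :=
  Real.exp (η * s ⟨i, v⟩) / ∑ v', Real.exp (η * s ⟨i, v'⟩)

/-- The log-sum-exp potential of the scores `s`, relative to the score of the full
assignment `y`. -/
noncomputable def expPotential {ι : Type*} {V : ι → Type*} [Fintype ι] [∀ i, Fintype (V i)] (η : ℝ)
    (y : ∀ i, V i) (s : (Σ i, V i) → ℝ) : ℝ :=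
  ∑ i, (Real.log (∑ v, Real.exp (η * s ⟨i, v⟩)) / η - s ⟨i, y i⟩)

section ExpWeights

variable {ι : Type*} {V : ι → Type*} [∀ i, Fintype (V i)]

theorem sum_exp_pos [∀ i, Nonempty (V i)] (η : ℝ) (s : (Σ i, V i) → ℝ) (i : ι) :
    0 < ∑ v, Real.exp (η * s ⟨i, v⟩) :=
  Finset.sum_pos (fun _ _ => Real.exp_pos _) Finset.univ_nonempty

theorem expWeights_nonneg (η : ℝ) (s : (Σ i, V i) → ℝ) (i : ι) (v : V i) :
    0 ≤ expWeights η s i v := by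
  unfold expWeights; positivity

theorem sum_expWeights [∀ i, Nonempty (V i)] (η : ℝ) (s : (Σ i, V i) → ℝ) (i : ι) :
    ∑ v, expWeights η s i v = 1 := by
  simp only [expWeights, ← Finset.sum_div]
  exact div_self (sum_exp_pos η s i).ne'

theorem expWeights_le_one [∀ i, Nonempty (V i)] (η : ℝ) (s : (Σ i, V i) → ℝ) (i : ι) (v : V i) :
    expWeights η s i v ≤ 1 :=
  (Finset.single_le_sum (fun v _ => expWeights_nonneg η s i v) (Finset.mem_univ v)).trans_eq
    (sum_expWeights η s i)

theorem measurable_expWeights (η : ℝ) (i : ι) (v : V i) :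
    Measurable fun s : (Σ i, V i) → ℝ => expWeights η s i v := by
  unfold expWeights; fun_prop

variable [Fintype ι]

theorem measurable_expPotential (η : ℝ) (y : ∀ i, V i) : Measurable (expPotential η y) := by
  unfold expPotential; fun_prop

theorem expPotential_nonneg {η : ℝ} (hη : 0 < η) (y : ∀ i, V i) (s : (Σ i, V i) → ℝ) :
    0 ≤ expPotential η y s := by
  refine Finset.sum_nonneg fun i _ => sub_nonneg.2 ?_
  rw [le_div_iff₀ hη, mul_comm]
  refine (Real.log_exp _).symm.trans_le (Real.log_le_log (Real.exp_pos _) ?_)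
  exact Finset.single_le_sum (f := fun v => Real.exp (η * s ⟨i, v⟩))
    (fun v _ => (Real.exp_pos _).le) (Finset.mem_univ (y i))

theorem expPotential_zero_le {η : ℝ} (hη : 0 < η) (y : ∀ i, V i) :
    expPotential η y (fun _ => 0) ≤ Fintype.card (Σ i, V i) / η := by
  rw [Fintype.card_sigma]
  push_cast
  rw [Finset.sum_div]
  refine Finset.sum_le_sum fun i _ => ?_
  simp only [mul_zero, Real.exp_zero, Finset.sum_const, Finset.card_univ, nsmul_eq_mul, mul_one,
    sub_zero]
  gcongr
  exact Real.log_le_self (Nat.cast_nonneg _)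

theorem exp_le_one_add_add_mul_sq {w B : ℝ} (hw : 0 ≤ w) (hB : w ≤ B) :
    Real.exp w ≤ 1 + w + Real.exp B * w ^ 2 := by
  have h1 : Real.exp w - 1 ≤ w * Real.exp w := by
    have h := mul_le_mul_of_nonneg_right (Real.add_one_le_exp (-w)) (Real.exp_pos w).le
    rw [← Real.exp_add, neg_add_cancel, Real.exp_zero] at h
    linarith
  have h2 : Real.exp w ≤ Real.exp B := Real.exp_le_exp.2 hB
  nlinarith [mul_le_mul_of_nonneg_left h1 hw, mul_le_mul_of_nonneg_left h2 (sq_nonneg w)]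

/-- The exponential weights inequality: raising the score of the item `v` of slot `k` by `z` raises
the potential by at most the expected gain of slot `k` minus the gain of `y`, plus a second-order
term. -/
theorem expPotential_update_sub_le [DecidableEq ι] [∀ i, DecidableEq (V i)] [∀ i, Nonempty (V i)]
    {η : ℝ} (hη : 0 < η) (y : ∀ i, V i) (s : (Σ i, V i) → ℝ) (k : ι) (v : V k) {z B : ℝ}
    (hz : 0 ≤ z) (hB : η * z ≤ B) :
    expPotential η y (Function.update s ⟨k, v⟩ (s ⟨k, v⟩ + z)) - expPotential η y s ≤
      expWeights η s k v * (z + η * Real.exp B * z ^ 2) - if y k = v then z else 0 := by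
  set s' := Function.update s ⟨k, v⟩ (s ⟨k, v⟩ + z) with hs'
  have hne : ∀ i, i ≠ k → ∀ v', s' ⟨i, v'⟩ = s ⟨i, v'⟩ := fun i hi v' => by
    rw [hs', Function.update_of_ne]
    intro h; exact hi (congrArg Sigma.fst h)
  have hk : ∀ v', s' ⟨k, v'⟩ = s ⟨k, v'⟩ + if v' = v then z else 0 := fun v' => by
    by_cases h : v' = v
    · subst h; simp [hs']
    · rw [hs', Function.update_of_ne, if_neg h, add_zero]
      simpa using h
  unfold expPotential
  rw [← Finset.sum_sub_distrib, Finset.sum_eq_single k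
    (fun i _ hi => by simp only [hne i hi, sub_self]) (by simp)]
  set E := ∑ v', Real.exp (η * s ⟨k, v'⟩) with hE
  have hEpos : 0 < E := sum_exp_pos η s k
  set x := expWeights η s k v with hx
  have hx0 : 0 ≤ x := expWeights_nonneg η s k v
  have hxE : Real.exp (η * s ⟨k, v⟩) = x * E := by
    rw [hx, expWeights, div_mul_cancel₀ _ hEpos.ne']
  have h1 : ∑ v', Real.exp (η * s' ⟨k, v'⟩) = E * (1 + x * (Real.exp (η * z) - 1)) := by
    have h2 : ∀ v', Real.exp (η * s' ⟨k, v'⟩) = Real.exp (η * s ⟨k, v'⟩) +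
        if v' = v then Real.exp (η * s ⟨k, v⟩) * (Real.exp (η * z) - 1) else 0 := by
      intro v'
      rw [hk]
      split_ifs with h
      · subst h; rw [mul_add, Real.exp_add]; ring
      · simp
    simp only [h2, Finset.sum_add_distrib, Finset.sum_ite_eq', Finset.mem_univ, if_true, hxE]
    rw [← hE]; ring
  have hu : 0 ≤ x * (Real.exp (η * z) - 1) :=
    mul_nonneg hx0 (sub_nonneg.2 (Real.one_le_exp (by positivity)))
  have h3 : Real.log (1 + x * (Real.exp (η * z) - 1)) ≤
      η * (x * (z + η * Real.exp B * z ^ 2)) := by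
    refine (Real.log_le_sub_one_of_pos (by linarith)).trans ?_
    have h4 := exp_le_one_add_add_mul_sq (by positivity : 0 ≤ η * z) hB
    have h5 := mul_le_mul_of_nonneg_left h4 hx0
    linarith
  have h6 : Real.log (1 + x * (Real.exp (η * z) - 1)) / η ≤ x * (z + η * Real.exp B * z ^ 2) := by
    rw [div_le_iff₀ hη]; linarith
  rw [h1, Real.log_mul hEpos.ne' (by linarith), add_div, hk]
  linarith

end ExpWeights

/-! ### The randomized strategy -/

/-- The random data of one round: an assignment and, in an exploration round, a level, a colouring
of the slots, and the item to be explored. -/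
abbrev SlotDraw {ι : Type*} (V : ι → Type*) (N : ℕ) :=
  (∀ i, V i) × Option (Fin N × (ι → Fin N) × (Σ i, V i))

section Strategy

variable {ι : Type*} {V : ι → Type*} [Fintype ι] [∀ i, Fintype (V i)] {N : ℕ}

/-- The distribution of the draw: the items are chosen independently by exponential weights, a round
is used for exploration with probability `γ`, and all exploration data are equally likely. -/
noncomputable def drawWeight (η γ : ℝ) (s : (Σ i, V i) → ℝ) (d : SlotDraw V N) : ℝ :=
  (∏ i, expWeights η s i (d.1 i)) * d.2.elim (1 - γ)
    fun _ => γ / (N * N ^ Fintype.card ι * Fintype.card (Σ i, V i))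

/-- The partial assignment that is played: the full assignment drawn or, in an exploration round,
its restriction to the chosen level set, modified to contain the explored item. -/
def SlotDraw.played [DecidableEq ι] (d : SlotDraw V N) : (∀ i, V i) × Finset ι :=
  match d.2 with
  | none => (d.1, Finset.univ)
  | some (j, c, p) => (Function.update d.1 p.1 p.2, insert p.1 (levelSet c (j + 1)))

/-- The new scores after observing the reward `r`: an exploration round adds an importance-weighted
estimate to the score of the explored item. -/
noncomputable def SlotDraw.newScores [DecidableEq ι] [∀ i, DecidableEq (V i)] (γ : ℝ)
    (s : (Σ i, V i) → ℝ) (d : SlotDraw V N) (r : ℝ) : (Σ i, V i) → ℝ :=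
  match d.2 with
  | none => s
  | some (j, _, p) =>
    Function.update s p (s p + Fintype.card (Σ i, V i) / γ * discount N ^ (N - j : ℕ) * r)

theorem drawWeight_nonneg {η γ : ℝ} (hγ0 : 0 ≤ γ) (hγ1 : γ ≤ 1) (s : (Σ i, V i) → ℝ)
    (d : SlotDraw V N) : 0 ≤ drawWeight η γ s d := by
  refine mul_nonneg (Finset.prod_nonneg fun i _ => expWeights_nonneg η s i _) ?_
  rcases d.2 with _ | e
  · exact sub_nonneg.2 hγ1
  · change 0 ≤ γ / _
    positivity

theorem sum_drawWeight_mul [DecidableEq ι] (η γ : ℝ) (s : (Σ i, V i) → ℝ) (H : SlotDraw V N → ℝ) :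
    ∑ d, drawWeight η γ s d * H d = ∑ a : ∀ i, V i, (∏ i, expWeights η s i (a i)) *
      ((1 - γ) * H (a, none) + ∑ e, γ / (N * N ^ Fintype.card ι * Fintype.card (Σ i, V i)) *
        H (a, some e)) := by
  rw [Fintype.sum_prod_type]
  refine Finset.sum_congr rfl fun a _ => ?_
  rw [Fintype.sum_option, mul_add, Finset.mul_sum]
  simp only [drawWeight, Option.elim_none, Option.elim_some, mul_assoc]

theorem card_mul_weight [DecidableEq ι] [Nonempty (Σ i, V i)] (hN : 0 < N) (γ : ℝ) :
    ∑ _e : Fin N × (ι → Fin N) × (Σ i, V i),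
      γ / (N * N ^ Fintype.card ι * Fintype.card (Σ i, V i)) = γ := by
  have hn : (0 : ℝ) < Fintype.card (Σ i, V i) := by exact_mod_cast Fintype.card_pos
  have hN' : (0 : ℝ) < N := by exact_mod_cast hN
  rw [Finset.sum_const, Finset.card_univ, Fintype.card_prod, Fintype.card_prod, Fintype.card_fun,
    Fintype.card_fin, nsmul_eq_mul]
  push_cast
  field_simp

theorem sum_drawWeight [DecidableEq ι] [Nonempty (Σ i, V i)] [∀ i, Nonempty (V i)] (hN : 0 < N)
    (η γ : ℝ) (s : (Σ i, V i) → ℝ) : ∑ d : SlotDraw V N, drawWeight η γ s d = 1 := by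
  have h := sum_drawWeight_mul (N := N) η γ s fun _ => 1
  simp only [mul_one, card_mul_weight hN, sub_add_cancel] at h
  rw [h]
  exact sum_prod_eq_one _ (sum_expWeights η s)

theorem measurable_drawWeight (η γ : ℝ) (d : SlotDraw V N) :
    Measurable fun s : (Σ i, V i) → ℝ => drawWeight η γ s d :=
  (Finset.measurable_prod _ fun i _ => measurable_expWeights η i (d.1 i)).mul_const _

theorem measurable_newScores [DecidableEq ι] [∀ i, DecidableEq (V i)] (γ : ℝ) (d : SlotDraw V N) :
    Measurable fun p : ((Σ i, V i) → ℝ) × ℝ => d.newScores γ p.1 p.2 := by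
  rcases d with ⟨a, _ | ⟨j, c, q⟩⟩
  · exact measurable_fst
  · refine measurable_pi_lambda _ fun q' => ?_
    simp only [SlotDraw.newScores, Function.update_apply]
    split_ifs <;> fun_prop

/-- The one-round inequality. Without the second-order term and the cost of exploration, the expected
increase of the potential pays for the expected regret against `y`: the estimates are unbiased for
the discounted rewards in `IsSlotReward.boosting`, and the term with the item of the drawn
assignment itself arises by redrawing that item. -/
theorem IsSlotReward.sum_drawWeight_mul_le [DecidableEq ι] [∀ i, DecidableEq (V i)]
    [Nonempty (Σ i, V i)] [∀ i, Nonempty (V i)] {M : ℝ} {F : (∀ i, V i) → Finset ι → ℝ}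
    (hF : IsSlotReward M F) (hN : 0 < N) {η γ : ℝ} (hη : 0 < η) (hγ0 : 0 < γ)
    (hηγ : η * Fintype.card (Σ i, V i) ≤ γ) (y : ∀ i, V i) (s : (Σ i, V i) → ℝ) :
    ∑ d : SlotDraw V N, drawWeight η γ s d *
      ((1 - discount N ^ N) * F y Finset.univ - F d.played.1 d.played.2 +
        (expPotential η y (d.newScores γ s (F d.played.1 d.played.2)) - expPotential η y s)) ≤
      2 * γ * M + η * Real.exp M * M ^ 2 * Fintype.card (Σ i, V i) ^ 2 / γ := by
  have hN' : (0 : ℝ) < N := by exact_mod_cast hN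
  set n : ℝ := ((Fintype.card (Σ i, V i) : ℕ) : ℝ) with hn
  have hn0 : 0 < n := by rw [hn]; exact_mod_cast Fintype.card_pos
  have hρ0 : 0 ≤ discount N := by unfold discount; positivity
  have hρ1 : discount N ≤ 1 := by
    unfold discount; rw [div_le_one (by positivity)]; linarith
  set x := expWeights η s with hx
  have hM : 0 ≤ M := (hF.nonneg y ∅).trans (hF.le_bound y ∅)
  set R := η * Real.exp M * M ^ 2 * n ^ 2 / γ with hR
  set β := 1 - discount N ^ N with hβ
  have hβ0 : 0 ≤ β := sub_nonneg.2 (pow_le_one₀ hρ0 hρ1)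
  have hβ1 : β ≤ 1 := by rw [hβ]; linarith [pow_nonneg hρ0 N]
  have hy0 : 0 ≤ β * F y Finset.univ := mul_nonneg hβ0 (hF.nonneg _ _)
  have hyM : β * F y Finset.univ ≤ M :=
    (mul_le_of_le_one_left (hF.nonneg _ _) hβ1).trans (hF.le_bound _ _)
  let ω : Fin N → ℝ := fun j => discount N ^ (N - j : ℕ) / (N * N ^ Fintype.card ι)
  let A : Fin N → (ι → Fin N) → ι → Finset ι := fun j c k => insert k (levelSet c (j + 1))
  -- Gains of slot `k` with a fresh item, with the item of `y`, and with the drawn item.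
  let T₁ : (∀ i, V i) → ℝ := fun a =>
    ∑ j, ∑ c, ω j * ∑ k, ∑ v, x k v * F (Function.update a k v) (A j c k)
  let T₂ : (∀ i, V i) → ℝ := fun a =>
    ∑ j, ∑ c, ω j * ∑ k, F (Function.update a k (y k)) (A j c k)
  let T₀ : (∀ i, V i) → ℝ := fun a => ∑ j, ∑ c, ω j * ∑ k, F a (A j c k)
  have hT₀₂ : ∀ a, T₀ a - T₂ a ≤ F a Finset.univ - β * F y Finset.univ := by
    intro a
    refine le_trans (le_of_eq ?_) (hF.boosting hN y a)
    simp only [T₀, T₂, Finset.sum_sub_distrib, mul_sub, ω, A]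
  have hT₁₀ : ∑ a, (∏ i, x i (a i)) * T₁ a = ∑ a, (∏ i, x i (a i)) * T₀ a := by
    simp only [T₁, T₀, Finset.mul_sum _ _ (∏ i, x i _)]
    rw [Finset.sum_comm, Finset.sum_comm (s := (Finset.univ : Finset (∀ i, V i)))]
    refine Finset.sum_congr rfl fun j _ => ?_
    rw [Finset.sum_comm, Finset.sum_comm (s := (Finset.univ : Finset (∀ i, V i)))]
    refine Finset.sum_congr rfl fun c _ => ?_
    simp only [mul_left_comm _ (ω j), ← Finset.mul_sum _ _ (ω j)]
    congr 1
    simp only [Finset.mul_sum _ _ (∏ i, x i _)]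
    rw [Finset.sum_comm, Finset.sum_comm (s := (Finset.univ : Finset (∀ i, V i)))]
    refine Finset.sum_congr rfl fun k _ => ?_
    rw [sum_prod_mul_eq_resample x k (sum_expWeights η s k) fun a => F a (A j c k)]
    simp only [Finset.mul_sum]
  have hexp : ∀ (a : ∀ i, V i), ∑ e, γ / (N * N ^ Fintype.card ι * n) *
      (β * F y Finset.univ - F (SlotDraw.played (V := V) (N := N) (a, some e)).1
          (SlotDraw.played (V := V) (N := N) (a, some e)).2 +
        (expPotential η y (SlotDraw.newScores γ s (a, some e)
          (F (SlotDraw.played (V := V) (N := N) (a, some e)).1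
            (SlotDraw.played (V := V) (N := N) (a, some e)).2)) - expPotential η y s)) ≤
      γ * M + R + (T₁ a - T₂ a) := by
    intro a
    have h1 : ∑ _e : Fin N × (ι → Fin N) × (Σ i, V i), γ / (N * N ^ Fintype.card ι * n) *
        (M + R / γ) = γ * M + R := by
      rw [← Finset.sum_mul, card_mul_weight hN]
      field_simp
    have h2 : T₁ a - T₂ a = ∑ e : Fin N × (ι → Fin N) × (Σ i, V i), ω e.1 *
        (x e.2.2.1 e.2.2.2 * F (Function.update a e.2.2.1 e.2.2.2) (A e.1 e.2.1 e.2.2.1) -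
          if y e.2.2.1 = e.2.2.2 then
            F (Function.update a e.2.2.1 e.2.2.2) (A e.1 e.2.1 e.2.2.1) else 0) := by
      simp only [Fintype.sum_prod_type, Fintype.sum_sigma, T₁, T₂, ← Finset.sum_sub_distrib,
        ← mul_sub, ← Finset.mul_sum]
      simp only [Finset.sum_sub_distrib, Finset.sum_ite_eq, Finset.mem_univ, if_true]
    rw [h2, ← h1, ← Finset.sum_add_distrib]
    refine Finset.sum_le_sum ?_
    rintro ⟨j, c, k, v⟩ -
    simp only [SlotDraw.played, SlotDraw.newScores]
    set r := F (Function.update a k v) (insert k (levelSet c (j + 1))) with hr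
    have hr0 : 0 ≤ r := hF.nonneg _ _
    have hrM : r ≤ M := hF.le_bound _ _
    set θ := discount N ^ (N - j : ℕ) with hθ
    have hθ0 : 0 ≤ θ := pow_nonneg hρ0 _
    have hθ1 : θ ≤ 1 := pow_le_one₀ hρ0 hρ1
    set z := n / γ * θ * r with hz
    have hz0 : 0 ≤ z := by positivity
    have hzM : z ≤ n / γ * M := by
      rw [hz, mul_assoc]
      refine mul_le_mul_of_nonneg_left ?_ (by positivity)
      exact (mul_le_of_le_one_left hr0 hθ1).trans hrM
    have hηz : η * z ≤ M := by
      calc η * z ≤ η * (n / γ * M) := mul_le_mul_of_nonneg_left hzM hη.le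
        _ = (η * n / γ) * M := by ring
        _ ≤ 1 * M := by
          refine mul_le_mul_of_nonneg_right ?_ hM
          rw [div_le_one hγ0]; exact hηγ
        _ = M := one_mul M
    have hpot := expPotential_update_sub_le hη y s k v hz0 hηz
    have hsq : x k v * (η * Real.exp M * z ^ 2) ≤ R / γ := by
      calc x k v * (η * Real.exp M * z ^ 2) ≤ 1 * (η * Real.exp M * (n / γ * M) ^ 2) := by
            have := expWeights_le_one η s k v
            have := expWeights_nonneg η s k v
            gcongr
        _ = R / γ := by rw [hR]; field_simp
    have hωz : ω j * r = γ / (N * N ^ Fintype.card ι * n) * z := by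
      simp only [ω, hz, ← hθ]; field_simp
    have hc : 0 ≤ γ / (N * N ^ Fintype.card ι * n) := by positivity
    change _ ≤ γ / (N * N ^ Fintype.card ι * n) * (M + R / γ) +
      ω j * (x k v * r - if y k = v then r else 0)
    have h3 : ω j * (x k v * r - if y k = v then r else 0) =
        γ / (N * N ^ Fintype.card ι * n) * (x k v * z - if y k = v then z else 0) := by
      split_ifs
      · linear_combination (x k v - 1) * hωz
      · linear_combination x k v * hωz
    rw [h3, ← mul_add]
    refine mul_le_mul_of_nonneg_left ?_ hc
    change expPotential η y (Function.update s ⟨k, v⟩ (s ⟨k, v⟩ + z)) - _ ≤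
      x k v * (z + η * Real.exp M * z ^ 2) - _ at hpot
    rw [mul_add] at hpot
    linarith
  rw [sum_drawWeight_mul]
  have hW0 : ∀ a : ∀ i, V i, 0 ≤ ∏ i, x i (a i) := fun a =>
    Finset.prod_nonneg fun i _ => expWeights_nonneg η s i _
  have hW1 : ∑ a : ∀ i, V i, ∏ i, x i (a i) = 1 := sum_prod_eq_one _ (sum_expWeights η s)
  have hmain : ∀ a : ∀ i, V i, (∏ i, x i (a i)) * ((1 - γ) * (β * F y Finset.univ -
        F a Finset.univ + (expPotential η y s - expPotential η y s)) +
      ∑ e, γ / (N * N ^ Fintype.card ι * n) *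
      (β * F y Finset.univ - F (SlotDraw.played (V := V) (N := N) (a, some e)).1
          (SlotDraw.played (V := V) (N := N) (a, some e)).2 +
        (expPotential η y (SlotDraw.newScores γ s (a, some e)
          (F (SlotDraw.played (V := V) (N := N) (a, some e)).1
            (SlotDraw.played (V := V) (N := N) (a, some e)).2)) - expPotential η y s))) ≤
      (∏ i, x i (a i)) * (2 * γ * M + R) +
        ((∏ i, x i (a i)) * T₁ a - (∏ i, x i (a i)) * T₀ a) := by
    intro a
    rw [← mul_sub, ← mul_add]
    refine mul_le_mul_of_nonneg_left ?_ (hW0 a)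
    have h1 := hexp a
    have h2 := hT₀₂ a
    have h3 : 0 ≤ γ * (β * F y Finset.univ + (M - F a Finset.univ)) :=
      mul_nonneg hγ0.le (add_nonneg hy0 (sub_nonneg.2 (hF.le_bound _ _)))
    nlinarith
  refine (Finset.sum_le_sum fun a _ => hmain a).trans_eq ?_
  rw [Finset.sum_add_distrib, Finset.sum_sub_distrib, hT₁₀, sub_self, add_zero, ← Finset.sum_mul,
    hW1, one_mul]

end Strategy

/-! ### Regret of the strategy -/

theorem discount_pow_self_le {N : ℕ} (hN : 0 < N) :
    discount N ^ N ≤ 1 / Real.exp 1 + 1 / N := by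
  have hN' : (0 : ℝ) < N := by exact_mod_cast hN
  set v : ℝ := 1 / (N + 1) with hv
  have hv0 : 0 ≤ v := by positivity
  have hv1 : v ≤ 1 := by rw [hv, div_le_one (by positivity)]; linarith
  have hvN : v ≤ 1 / N := one_div_le_one_div_of_le hN' (by linarith)
  have hρ : discount N = 1 - v := by unfold discount; rw [hv]; field_simp; ring
  have h1 : discount N ≤ Real.exp (-v) := by
    rw [hρ]; linarith [Real.add_one_le_exp (-v)]
  have h2 : discount N ^ N ≤ Real.exp (-1) * Real.exp v := by
    refine (pow_le_pow_left₀ (by unfold discount; positivity) h1 N).trans_eq ?_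
    rw [← Real.exp_nat_mul, ← Real.exp_add]
    congr 1
    rw [hv]; field_simp; ring
  have h3 : Real.exp v ≤ 1 + v * Real.exp 1 := by
    have h4 := mul_le_mul_of_nonneg_right (Real.add_one_le_exp (-v)) (Real.exp_pos v).le
    rw [← Real.exp_add, neg_add_cancel, Real.exp_zero] at h4
    have h5 := mul_le_mul_of_nonneg_left (Real.exp_le_exp.2 hv1) hv0
    linarith
  have h6 := mul_le_mul_of_nonneg_left h3 (Real.exp_pos (-1)).le
  have h7 : Real.exp (-1) * (1 + v * Real.exp 1) = 1 / Real.exp 1 + v := by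
    rw [Real.exp_neg]; field_simp
  linarith

/-- The dependence of the regret bound on the bound `M` for the rewards. The exponential comes from
running exponential weights at a learning rate that is chosen without knowing `M`. -/
noncomputable def regretConstant (M : ℝ) : ℝ := 2 * (3 * M + Real.exp M * M ^ 2 + 1)

/-- Playing the same action in every round. -/
noncomputable def BanditAlgorithm.constant {𝒜 : Type u} (x₀ : 𝒜) : BanditAlgorithm 𝒜 where
  Seed := Unit
  law := Measure.dirac ()
  act := fun _ _ _ => x₀
  measurable_act := fun _ => measurable_const

theorem BanditAlgorithm.play_constant {𝒜 : Type u} (x₀ : 𝒜) (f : ℕ → 𝒜 → ℝ)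
    (ω : (BanditAlgorithm.constant x₀).Seed) (t : ℕ) :
    (BanditAlgorithm.constant x₀).play f ω t = x₀ := by
  rw [BanditAlgorithm.play_eq]; rfl

theorem le_regretConstant_mul {M X L : ℝ} (hM : 0 ≤ M) (hX : 0 ≤ X) (hL : 1 / 2 ≤ L) :
    (3 * M + Real.exp M * M ^ 2 + 1) * X ≤ regretConstant M * X * L := by
  have h : 0 ≤ (3 * M + Real.exp M * M ^ 2 + 1) * X := by positivity
  unfold regretConstant
  nlinarith

section SlotGame

variable {G : Type u} [DecidableEq G] {ι : Type*} {V : ι → Type*} [Fintype ι] [DecidableEq ι]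
  [∀ i, Fintype (V i)] [∀ i, DecidableEq (V i)] [∀ i, Nonempty (V i)]

/-- The strategy with `N = T` levels, exploration probability `γ = p ^ 5 / q` and learning rate
`η = 1 / (p ^ 2 q ^ 2)`, where `p ^ 3` is the number of pairs of a slot and an item and
`q ^ 3 = T`. -/
theorem exists_banditAlgorithm_of_slots {𝒮 : Set (Finset G)} (π : ∀ i, V i → G)
    (hπ : ∀ (a : ∀ i, V i) (A : Finset ι), A.image (fun i => π i (a i)) ∈ 𝒮)
    (hcov : ∀ S ∈ 𝒮, ∃ a : ∀ i, V i, S ⊆ Finset.univ.image fun i => π i (a i)) {T : ℕ}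
    (hT : 2 ≤ T) {p q : ℝ} (hp : 1 ≤ p) (hpq : p ^ 5 ≤ q)
    (hpn : p ^ 3 = Fintype.card (Σ i, V i)) (hqT : q ^ 3 = T) :
    ∃ alg : BanditAlgorithm 𝒮, ∀ (M : ℝ) (g : ℕ → Finset G → ℝ),
      (∀ t < T, IsMonotoneSubmodularReward 𝒮 M (g t)) → ∀ x : 𝒮,
        ∫ ω, ∑ t ∈ Finset.range T, ((1 - 1 / Real.exp 1) * g t x -
          g t (alg.play (fun t S => g t S) ω t)) ∂alg.law ≤
          (3 * M + Real.exp M * M ^ 2 + 1) * (p ^ 5 * q ^ 2) := by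
  have hp0 : 0 < p := by linarith
  have hq : 1 ≤ q := (one_le_pow₀ hp).trans hpq
  have hq0 : 0 < q := by linarith
  have hT0 : 0 < T := by omega
  have hn : 0 < Fintype.card (Σ i, V i) := by
    have : (0 : ℝ) < Fintype.card (Σ i, V i) := by rw [← hpn]; positivity
    exact_mod_cast this
  have : Nonempty (Σ i, V i) := Fintype.card_pos_iff.1 hn
  set γ := p ^ 5 / q with hγ
  set η := 1 / (p ^ 2 * q ^ 2) with hη
  have hγ0 : 0 < γ := by positivity
  have hγ1 : γ ≤ 1 := (div_le_one hq0).2 hpq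
  have hη0 : 0 < η := by positivity
  have hηγ : η * Fintype.card (Σ i, V i) ≤ γ := by
    rw [← hpn, hη, hγ, le_div_iff₀ hq0]
    have h1 : 1 / (p ^ 2 * q ^ 2) * p ^ 3 * q = p / q := by field_simp
    rw [h1, div_le_iff₀ hq0]
    have h2 : p ≤ p ^ 5 := le_self_pow₀ hp (by norm_num)
    exact h2.trans (le_mul_of_one_le_right (by positivity) hq)
  let act : SlotDraw V T → 𝒮 := fun d =>
    ⟨d.played.2.image fun i => π i (d.played.1 i), hπ _ _⟩
  have : Nonempty (SlotDraw V T) := ⟨(fun i => Classical.arbitrary (V i), none)⟩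
  obtain ⟨alg, halg⟩ := exists_banditAlgorithm_integral_le (D := SlotDraw V T)
    (drawWeight η γ) (drawWeight_nonneg hγ0.le hγ1) (sum_drawWeight hT0 η γ)
    (measurable_drawWeight η γ) act (fun s d r => d.newScores γ s r) (measurable_newScores γ)
    (fun _ => 0)
  refine ⟨alg, fun M g hg x => ?_⟩
  obtain ⟨y, hy⟩ := hcov x x.2
  have hM : 0 ≤ M := by
    have h1 := (hg 0 hT0).le_bound _ (hπ y ∅)
    rwa [Finset.image_empty, (hg 0 hT0).empty] at h1
  have hT' : (0 : ℝ) < T := by exact_mod_cast hT0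
  set n : ℝ := ((Fintype.card (Σ i, V i) : ℕ) : ℝ) with hndef
  have hbound := halg (fun t S => g t S)
    (fun t S => (1 - 1 / Real.exp 1) * g t x - g t S) (expPotential η y) T
    (2 * γ * M + η * Real.exp M * M ^ 2 * n ^ 2 / γ + M / T)
    (measurable_expPotential η y) (expPotential_nonneg hη0 y) ?_
  · refine hbound.trans ((add_le_add_right (expPotential_zero_le hη0 y) _).trans ?_)
    rw [← hndef, ← hpn, ← hqT, hγ, hη]
    have h1 : q ^ 3 * (2 * (p ^ 5 / q) * M + 1 / (p ^ 2 * q ^ 2) * Real.exp M * M ^ 2 *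
        (p ^ 3) ^ 2 / (p ^ 5 / q) + M / q ^ 3) + p ^ 3 / (1 / (p ^ 2 * q ^ 2)) =
        2 * M * (p ^ 5 * q ^ 2) + Real.exp M * M ^ 2 * (q ^ 2 / p) + M + p ^ 5 * q ^ 2 := by
      field_simp
    rw [h1]
    have h2 : q ^ 2 / p ≤ p ^ 5 * q ^ 2 := by
      rw [div_le_iff₀ hp0]
      have h3 : (1 : ℝ) ≤ p ^ 6 := one_le_pow₀ hp
      nlinarith [sq_nonneg q]
    have h4 : M ≤ M * (p ^ 5 * q ^ 2) :=
      le_mul_of_one_le_right hM (one_le_mul_of_one_le_of_one_le (one_le_pow₀ hp) (one_le_pow₀ hq))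
    have h5 := mul_le_mul_of_nonneg_left h2 (by positivity : 0 ≤ Real.exp M * M ^ 2)
    linarith
  · intro t ht s
    have hF := (hg t ht).isSlotReward π hπ
    set F : (∀ i, V i) → Finset ι → ℝ := fun a A => g t (A.image fun i => π i (a i)) with hFdef
    have h1 := hF.sum_drawWeight_mul_le hT0 hη0 hγ0 hηγ y s
    have h2 : (1 - 1 / Real.exp 1) * g t x ≤
        (1 - discount T ^ T) * F y Finset.univ + M / T := by
      have h3 : (1 - 1 / Real.exp 1) * g t x ≤ (1 - 1 / Real.exp 1) * F y Finset.univ := by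
        refine mul_le_mul_of_nonneg_left ((hg t ht).monotone hy) (sub_nonneg.2 ?_)
        rw [div_le_one (Real.exp_pos 1)]
        exact Real.one_le_exp zero_le_one
      have h4 : (discount T ^ T - 1 / Real.exp 1) * F y Finset.univ ≤ 1 / T * M := by
        refine (mul_le_mul_of_nonneg_right (sub_le_iff_le_add'.2 (discount_pow_self_le hT0))
          (hF.nonneg _ _)).trans ?_
        exact mul_le_mul_of_nonneg_left (hF.le_bound _ _) (by positivity)
      have h5 : 1 / (T : ℝ) * M = M / T := by ring
      linarith
    refine le_trans ?_ (add_le_add_left h1 (M / T))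
    have h6 : M / T = ∑ d : SlotDraw V T, drawWeight η γ s d * (M / T) := by
      rw [← Finset.sum_mul, sum_drawWeight hT0, one_mul]
    rw [h6, ← Finset.sum_add_distrib]
    refine Finset.sum_le_sum fun d _ => ?_
    rw [← mul_add]
    refine mul_le_mul_of_nonneg_left ?_ (drawWeight_nonneg hγ0.le hγ1 s d)
    simp only [hFdef, act] at h2 ⊢
    linarith

/-- If the images of all partial assignments are feasible and every feasible set is contained in the
image of a full assignment, there is an algorithm whose regret is bounded in terms of the number of
pairs of a slot and an item. -/
theorem exists_banditAlgorithm_regret_le {𝒮 : Set (Finset G)} (π : ∀ i, V i → G)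
    (hπ : ∀ (a : ∀ i, V i) (A : Finset ι), A.image (fun i => π i (a i)) ∈ 𝒮)
    (hcov : ∀ S ∈ 𝒮, ∃ a : ∀ i, V i, S ⊆ Finset.univ.image fun i => π i (a i)) {m : ℝ}
    (hm : Fintype.card (Σ i, V i) ≤ m) {T : ℕ} (hT : 2 ≤ T) :
    ∃ alg : BanditAlgorithm 𝒮, ∀ (M : ℝ) (g : ℕ → Finset G → ℝ),
      (∀ t < T, IsMonotoneSubmodularReward 𝒮 M (g t)) →
        alg.regret (1 - 1 / Real.exp 1) (fun t S => g t S) T ≤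
          regretConstant M * m ^ (5 / 3 : ℝ) * (T : ℝ) ^ (2 / 3 : ℝ) * Real.log T := by
  set n : ℝ := ((Fintype.card (Σ i, V i) : ℕ) : ℝ) with hn
  have hn0 : 0 ≤ n := Nat.cast_nonneg _
  have hm0 : 0 ≤ m := hn0.trans hm
  have hT' : (2 : ℝ) ≤ T := by exact_mod_cast hT
  have hT0 : (0 : ℝ) ≤ T := by linarith
  have hlog : 1 / 2 ≤ Real.log T := by
    refine le_trans ?_ (Real.log_le_log two_pos hT')
    linarith [Real.log_two_gt_d9]
  have hemp : ∅ ∈ 𝒮 := by simpa using hπ (fun i => Classical.arbitrary (V i)) ∅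
  set p := n ^ (1 / 3 : ℝ) with hp
  set q := (T : ℝ) ^ (1 / 3 : ℝ) with hq
  have hp0 : 0 ≤ p := Real.rpow_nonneg hn0 _
  have hq0 : 0 ≤ q := Real.rpow_nonneg hT0 _
  have hp3 : p ^ 3 = n := by
    rw [hp, ← Real.rpow_natCast, ← Real.rpow_mul hn0]; norm_num
  have hq3 : q ^ 3 = T := by
    rw [hq, ← Real.rpow_natCast, ← Real.rpow_mul hT0]; norm_num
  have hp5 : p ^ 5 = n ^ (5 / 3 : ℝ) := by
    rw [hp, ← Real.rpow_natCast, ← Real.rpow_mul hn0]; norm_num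
  have hq2 : q ^ 2 = (T : ℝ) ^ (2 / 3 : ℝ) := by
    rw [hq, ← Real.rpow_natCast, ← Real.rpow_mul hT0]; norm_num
  -- The factor `log T ≥ 1 / 2` is only needed to absorb a constant.
  have hfinish : ∀ (alg : BanditAlgorithm 𝒮), (∀ (M : ℝ) (g : ℕ → Finset G → ℝ),
      (∀ t < T, IsMonotoneSubmodularReward 𝒮 M (g t)) → ∀ x : 𝒮,
        ∫ ω, ∑ t ∈ Finset.range T, ((1 - 1 / Real.exp 1) * g t x -
          g t (alg.play (fun t S => g t S) ω t)) ∂alg.law ≤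
          (3 * M + Real.exp M * M ^ 2 + 1) * (p ^ 5 * q ^ 2)) →
      ∀ (M : ℝ) (g : ℕ → Finset G → ℝ), (∀ t < T, IsMonotoneSubmodularReward 𝒮 M (g t)) →
        alg.regret (1 - 1 / Real.exp 1) (fun t S => g t S) T ≤
          regretConstant M * m ^ (5 / 3 : ℝ) * (T : ℝ) ^ (2 / 3 : ℝ) * Real.log T := by
    intro alg h M g hg
    have hM : 0 ≤ M := by
      have h1 := (hg 0 (by omega)).le_bound _ hemp
      rwa [(hg 0 (by omega)).empty] at h1
    have hX : 0 ≤ m ^ (5 / 3 : ℝ) * (T : ℝ) ^ (2 / 3 : ℝ) := by positivity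
    have h2 := le_regretConstant_mul hM hX hlog
    rw [← mul_assoc (regretConstant M)] at h2
    have h3 : p ^ 5 * q ^ 2 ≤ m ^ (5 / 3 : ℝ) * (T : ℝ) ^ (2 / 3 : ℝ) := by
      rw [hp5, hq2]
      exact mul_le_mul_of_nonneg_right (Real.rpow_le_rpow hn0 hm (by norm_num)) (by positivity)
    have h4 := mul_le_mul_of_nonneg_left h3 (by positivity : 0 ≤ 3 * M + Real.exp M * M ^ 2 + 1)
    refine Real.iSup_le (fun x => (h M g hg x).trans (h4.trans h2)) ?_
    exact le_trans (by positivity) h2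
  by_cases hcase : 1 ≤ p ∧ p ^ 5 ≤ q
  · obtain ⟨alg, halg⟩ :=
      exists_banditAlgorithm_of_slots π hπ hcov hT hcase.1 hcase.2 hp3 hq3
    exact ⟨alg, hfinish alg halg⟩
  -- Otherwise there are no items, or the bound is larger than `M * T`.
  refine ⟨BanditAlgorithm.constant ⟨∅, hemp⟩, hfinish _ fun M g hg x => ?_⟩
  have hM : 0 ≤ M := by
    have h1 := (hg 0 (by omega)).le_bound _ hemp
    rwa [(hg 0 (by omega)).empty] at h1
  have hα1 : 1 - 1 / Real.exp 1 ≤ 1 := by linarith [one_div_pos.2 (Real.exp_pos 1)]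
  have hB : ∀ t < T, (1 - 1 / Real.exp 1) * g t x - g t ∅ ≤ if Fintype.card (Σ i, V i) = 0 then 0
      else M := by
    intro t ht
    rw [(hg t ht).empty, sub_zero]
    split_ifs with h0
    · have hx : (x : Finset G) = ∅ := by
        obtain ⟨a, ha⟩ := hcov x x.2
        have : IsEmpty ι := ⟨fun i =>
          (Fintype.card_eq_zero_iff.1 h0).false ⟨i, Classical.arbitrary _⟩⟩
        simpa using ha
      rw [hx, (hg t ht).empty, mul_zero]
    · have h1 : 0 ≤ g t x := (hg t ht).empty.ge.trans ((hg t ht).monotone (Finset.empty_subset _))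
      exact (mul_le_of_le_one_left h1 hα1).trans ((hg t ht).le_bound x x.2)
  have hsum : ∑ t ∈ Finset.range T, ((1 - 1 / Real.exp 1) * g t x - g t ∅) ≤
      (3 * M + Real.exp M * M ^ 2 + 1) * (p ^ 5 * q ^ 2) := by
    refine (Finset.sum_le_sum fun t ht => hB t (Finset.mem_range.1 ht)).trans ?_
    rw [Finset.sum_const, Finset.card_range, nsmul_eq_mul]
    split_ifs with h0
    · rw [mul_zero]; positivity
    · have hn1 : 1 ≤ n := by rw [hn]; exact_mod_cast Nat.one_le_iff_ne_zero.2 h0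
      have hp1 : 1 ≤ p := Real.one_le_rpow hn1 (by norm_num)
      have hqp : q ≤ p ^ 5 := (not_le.1 fun h => hcase ⟨hp1, h⟩).le
      have h1 : (T : ℝ) ≤ p ^ 5 * q ^ 2 := by
        rw [← hq3, pow_succ, mul_comm]
        exact mul_le_mul_of_nonneg_right hqp (by positivity)
      have h2 : M ≤ 3 * M + Real.exp M * M ^ 2 + 1 := by
        have : 0 ≤ Real.exp M * M ^ 2 := by positivity
        linarith
      rw [mul_comm]
      exact mul_le_mul h2 h1 hT0 (hM.trans h2)
  simp only [BanditAlgorithm.play_constant, integral_const, probReal_univ, one_smul]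
  exact hsum

end SlotGame

/-! ### Partition matroids and assignments -/

theorem exists_fin_cover {α : Type*} [Nonempty α] (B : Finset α) {r : ℕ} (h : B.card ≤ r) :
    ∃ f : Fin r → α, ∀ b ∈ B, ∃ j, f j = b := by
  classical
  refine ⟨fun j => if hj : (j : ℕ) < B.card then B.equivFin.symm ⟨j, hj⟩ else Classical.arbitrary α,
    fun b hb => ⟨⟨B.equivFin ⟨b, hb⟩, (B.equivFin ⟨b, hb⟩).2.trans_le h⟩, ?_⟩⟩
  simp

/-- The slots for a partition matroid are the `r_k` copies of each nonempty part `G_k`. -/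
theorem exists_banditAlgorithm_partitionMatroid {G : Type u} [Fintype G] [DecidableEq G]
    (P : PartitionMatroid G) {T : ℕ} (hT : 2 ≤ T) :
    ∃ alg : BanditAlgorithm P.indep, ∀ (M : ℝ) (g : ℕ → Finset G → ℝ),
      (∀ t < T, IsMonotoneSubmodularReward P.indep M (g t)) →
        alg.regret (1 - 1 / Real.exp 1) (fun t S => g t S) T ≤
          regretConstant M * (P.size : ℝ) ^ (5 / 3 : ℝ) * (T : ℝ) ^ (2 / 3 : ℝ) *
            Real.log T := by
  let ι := {p : (k : Fin P.K) × Fin (P.capacity k) // (P.part p.1).Nonempty}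
  let V : ι → Type u := fun p => {s // s ∈ P.part p.1.1}
  have hV : ∀ p : ι, Nonempty (V p) := fun p => p.2.to_subtype
  have hpart : ∀ {s k k'}, s ∈ P.part k → s ∈ P.part k' → k = k' := fun h h' =>
    (P.existsUnique_part _).unique h h'
  refine exists_banditAlgorithm_regret_le (ι := ι) (V := V) (fun p v => (v : G)) ?_ ?_ ?_ hT
  · intro a A k
    by_cases hk : (P.part k).Nonempty
    · have hsub : A.image (fun p => (a p : G)) ∩ P.part k ⊆
          Finset.univ.image fun j : Fin (P.capacity k) => (a ⟨⟨k, j⟩, hk⟩ : G) := by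
        intro s hs
        rw [Finset.mem_inter, Finset.mem_image] at hs
        obtain ⟨⟨⟨⟨k', j⟩, hk'⟩, -, rfl⟩, hs⟩ := hs
        obtain rfl := hpart (a ⟨⟨k', j⟩, hk'⟩).2 hs
        exact Finset.mem_image_of_mem _ (Finset.mem_univ j)
      exact (Finset.card_le_card hsub).trans (Finset.card_image_le.trans (by simp))
    · rw [Finset.not_nonempty_iff_eq_empty.1 hk]; simp
  · intro S hS
    have hf : ∀ k : {k // (P.part k).Nonempty}, ∃ f : Fin (P.capacity k) → {s // s ∈ P.part k},
        ∀ s : {s // s ∈ P.part k}, (s : G) ∈ S → ∃ j, f j = s := by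
      intro k
      have : Nonempty {s // s ∈ P.part k} := k.2.to_subtype
      obtain ⟨f, hf⟩ := exists_fin_cover
        (Finset.univ.filter fun s : {s // s ∈ P.part k} => (s : G) ∈ S) (r := P.capacity k) (by
          refine le_trans ?_ (hS k)
          refine Finset.card_le_card_of_injOn Subtype.val ?_ Subtype.val_injective.injOn
          intro s hs
          simpa using hs)
      exact ⟨f, fun s hs => hf s (by simpa using hs)⟩
    choose f hf using hf
    refine ⟨fun p => f ⟨p.1.1, p.2⟩ p.1.2, fun s hs => ?_⟩
    obtain ⟨k, hk, -⟩ := P.existsUnique_part s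
    obtain ⟨j, hj⟩ := hf ⟨k, ⟨s, hk⟩⟩ ⟨s, hk⟩ hs
    exact Finset.mem_image.2 ⟨⟨⟨k, j⟩, ⟨s, hk⟩⟩, Finset.mem_univ _, congrArg Subtype.val hj⟩
  · have hcard : Fintype.card (Σ p, V p) ≤
        Fintype.card ((k : Fin P.K) × (Fin (P.capacity k) × {s // s ∈ P.part k})) := by
      refine Fintype.card_le_of_injective (fun x => ⟨x.1.1.1, x.1.1.2, x.2⟩) ?_
      rintro ⟨⟨⟨k, j⟩, h⟩, v⟩ ⟨⟨⟨k', j'⟩, h'⟩, v'⟩ heq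
      obtain rfl : k = k' := congrArg Sigma.fst heq
      simp only [Sigma.mk.injEq, heq_eq_eq, Prod.mk.injEq, true_and] at heq
      obtain ⟨rfl, rfl⟩ := heq
      rfl
    have : Fintype.card ((k : Fin P.K) × (Fin (P.capacity k) × {s // s ∈ P.part k})) = P.size := by
      simp [PartitionMatroid.size]
    rw [this] at hcard
    exact_mod_cast hcard

/-- The slots for the assignment problem are the positions with at least one item. -/
theorem exists_banditAlgorithm_assignments {K : ℕ} (V : Fin K → Type u) [∀ k, Fintype (V k)]
    [∀ k, DecidableEq (V k)] {T : ℕ} (hT : 2 ≤ T) :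
    ∃ alg : BanditAlgorithm (assignments V),
      ∀ (M : ℝ) (g : ℕ → Finset ((k : Fin K) × V k) → ℝ),
      (∀ t < T, IsMonotoneSubmodularReward (assignments V) M (g t)) →
        alg.regret (1 - 1 / Real.exp 1) (fun t S => g t S) T ≤
          regretConstant M * (∑ k, (Fintype.card (V k) : ℝ)) ^ (5 / 3 : ℝ) *
            (T : ℝ) ^ (2 / 3 : ℝ) * Real.log T := by
  classical
  let ι := {k : Fin K // Nonempty (V k)}
  have hV : ∀ k : ι, Nonempty (V k) := fun k => k.2
  refine exists_banditAlgorithm_regret_le (ι := ι) (V := fun k => V k)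
    (fun k v => (⟨k, v⟩ : (k : Fin K) × V k)) ?_ ?_ ?_ hT
  · intro a A x hx y hy hxy
    obtain ⟨i, -, rfl⟩ := Finset.mem_image.1 hx
    obtain ⟨j, -, rfl⟩ := Finset.mem_image.1 hy
    obtain rfl : i = j := Subtype.ext hxy
    rfl
  · intro S hS
    refine ⟨fun k => if h : ∃ v, (⟨k, v⟩ : (k : Fin K) × V k) ∈ S then h.choose
      else Classical.arbitrary _, ?_⟩
    rintro ⟨k, v⟩ hkv
    have h : ∃ v, (⟨k, v⟩ : (k : Fin K) × V k) ∈ S := ⟨v, hkv⟩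
    refine Finset.mem_image.2 ⟨⟨k, ⟨v⟩⟩, Finset.mem_univ _, ?_⟩
    simp only [h, dite_true]
    exact hS _ h.choose_spec _ hkv rfl
  · have hcard : Fintype.card ((k : ι) × V k) ≤ Fintype.card ((k : Fin K) × V k) := by
      refine Fintype.card_le_of_injective (fun x => ⟨x.1, x.2⟩) ?_
      rintro ⟨⟨k, h⟩, v⟩ ⟨⟨k', h'⟩, v'⟩ heq
      obtain rfl : k = k' := congrArg Sigma.fst heq
      simp only [Sigma.mk.injEq, heq_eq_eq, true_and] at heq
      rw [heq]
    rw [Fintype.card_sigma (α := fun k => V k) (ι := Fin K)] at hcard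
    exact_mod_cast hcard

theorem corollary5p4 :
    ∃ C : ℝ → ℝ,
      (∀ (G : Type u) [Fintype G] [DecidableEq G] (P : PartitionMatroid G) (T : ℕ), 2 ≤ T →
        ∃ alg : BanditAlgorithm P.indep, ∀ (M : ℝ) (g : ℕ → Finset G → ℝ),
          (∀ t < T, IsMonotoneSubmodularReward P.indep M (g t)) →
            alg.regret (1 - 1 / Real.exp 1) (fun t S => g t S) T ≤
              C M * (P.size : ℝ) ^ (5 / 3 : ℝ) * (T : ℝ) ^ (2 / 3 : ℝ) * Real.log T) ∧
      (∀ (K : ℕ) (V : Fin K → Type u) [∀ k, Fintype (V k)] [∀ k, DecidableEq (V k)] (T : ℕ),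
        2 ≤ T →
        ∃ alg : BanditAlgorithm (assignments V),
          ∀ (M : ℝ) (g : ℕ → Finset ((k : Fin K) × V k) → ℝ),
          (∀ t < T, IsMonotoneSubmodularReward (assignments V) M (g t)) →
            alg.regret (1 - 1 / Real.exp 1) (fun t S => g t S) T ≤
              C M * (∑ k, (Fintype.card (V k) : ℝ)) ^ (5 / 3 : ℝ) * (T : ℝ) ^ (2 / 3 : ℝ) *
                Real.log T) := by
  exact ⟨regretConstant, fun G _ _ P T hT => exists_banditAlgorithm_partitionMatroid P hT,
    fun K V _ _ T hT => exists_banditAlgorithm_assignments V hT⟩
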